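/- Let $\mathbb D$ be the open unit disc, $n\ge 1$ an integer, and for a complex Hilbert space $E$ let $\mathcal M_{n,E}$ be the Hilbert space of $E$-valued holomorphic functions on $\mathbb D$ with reproducing kernel $K_n(z,u)I_E$, $K_n(z,u)=(1-z\bar u)^{-n}$. Write $\mathcal M_n=\mathcal M_{n,\mathbb C}$, let $S_{n,E}f(z)=zf(z)$ be the forward shift on $\mathcal M_{n,E}$, $S_{n,E}^*$ its adjoint (the backward shift), $S_n^*=S_{n,\mathbb C}^*$, and for $f\in\mathcal M_n$, $x\in E$ identify $f\otimes x$ with the function $z\mapsto f(z)x$ in $\mathcal M_{n,E}$. Let $T$ be a bounded operator on a complex Hilbert space $\mathcal H$ in the Cowen–Douglas class $\mathcal B_m(\mathbb D)$; that is, $\mathbb D\subset\sigma(T)$, and $\dim\ker(T-w)=m$ and $\operatorname{ran}(T-w)=\mathcal H$ for every $w\in\mathbb D$, and $\bigvee_{w\in\mathbb D}\ker(T-w)=\mathcal H$. Suppose that $T$ is an $n$-hypercontraction, i.e. $\sum_{j=0}^k(-1)^j\binom kj (T^*)^jT^j\ge 0$ for $1\le k\le n$. Let $D_T=\big(\sum_{j=0}^n(-1)^j\binom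 nj (T^*)^jT^j\big)^{1/2}$ and $E=\overline{\operatorname{ran}D_T}$. For an operator $A$ let $\mathcal E_A$ be the family of eigenspaces $\mathcal E_A(w)=\ker(A-w)$, $w\in\mathbb D$, let $\mathcal E_{D_T}(w)=D_T\ker(T-w)\subset E$, and let $(\mathcal E_{S_n^*}\otimes\mathcal E_{D_T})(w)=\mathcal E_{S_n^*}(w)\otimes\mathcal E_{D_T}(w)\subset\mathcal M_n\otimes E$; all these subspaces carry the inherited inner products. Such a family is a Hermitian holomorphic vector bundle of rank $r$ over $\mathbb D$ if near every point of $\mathbb D$ it has a holomorphic frame of $r$ sections. An equivalence of two Hermitian holomorphic vector bundles is a family of isometric linear bijections between the fibres under which holomorphic sections correspond to holomorphic sections in both directions. Then: 1. $\mathcal E_T$, $\mathcal E_{S_n^*}$, $\mathcal E_{D_T}$ and $\mathcal E_{S_n^*}\otimes\mathcal E_{D_T}$ are Hermitian holomorphic vector bundles over $\mathbb D$, of rank $m$, $1$, $m$ and $m$ respectively. If $\gamma_1,\dots,\gamma_m$ is a holomorphic frame of $\mathcal E_T$ over an open set $U\subset\mathbb D$, then $D_T\gamma_1,\dots,D_T\gamma_m$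 is a holomorphic frame of $\mathcal E_{D_T}$ over $U$. 2. For every $x\in\mathcal H$ the series $Vx=\sum_{k\ge0}\frac{z^k}{\|z^k\|^2_{\mathcal M_n}}\otimes D_TT^kx$ converges in $\mathcal M_{n,E}$, and it defines a linear isometry $V:\mathcal H\to\mathcal M_{n,E}$ with $VT=S^*_{n,E}V$. 3. $\mathcal E_T$ and $\mathcal E_{S_n^*}\otimes\mathcal E_{D_T}$ are equivalent as Hermitian holomorphic vector bundles, through the maps $\Phi_w:\ker(T-w)\to\mathcal E_{S_n^*}(w)\otimes\mathcal E_{D_T}(w)$, $\Phi_w x=K_n(\cdot,\bar w)\otimes D_Tx$, and under the identification above $\Phi_wx=Vx$ for $w\in\mathbb D$, $x\in\ker(T-w)$. Moreover, inside $\mathcal M_{n,E}$, $(\mathcal E_{S_n^*}\otimes\mathcal E_{D_T})(w)=\ker(S_{n,E}^*-w)\cap\operatorname{ran}V$ for $w\in\mathbb D$, and $\operatorname{ran}V$ is the closed linear span of these subspaces over all $w\in\mathbb D$. -/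

import Mathlib

open scoped ComplexConjugate TensorProduct InnerProductSpace

noncomputable section

set_option linter.unusedSectionVars false

namespace CowenDouglas

/-! ### The disc -/

/-- The open unit disc as a subset of `ℂ`. -/
abbrev disc : Set ℂ := Metric.ball (0 : ℂ) 1

/-- Complex conjugation on the unit disc. -/
def conjDisc (w : disc) : disc :=
  ⟨conj (w : ℂ), by
    have h := w.2
    rw [mem_ball_zero_iff] at h ⊢
    rwa [RCLike.norm_conj]⟩

/-! ### The spaces `𝓜ₙ,ᴱ` and their shifts -/

section ModelSpace

variable {E : Type*} [NormedAddCommGroup E] [InnerProductSpace ℂ E]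

/-- The coefficient of `x ^ k` in the power series of `(1 - x) ^ (-n)`. -/
def weight (n : ℕ+) (k : ℕ) : ℝ := ((k + ((n : ℕ) - 1)).choose ((n : ℕ) - 1) : ℕ)

lemma weight_pos (n : ℕ+) (k : ℕ) : 0 < weight n k := by
  unfold weight
  exact_mod_cast Nat.choose_pos (Nat.le_add_left _ _)

lemma weight_mono (n : ℕ+) (k : ℕ) : weight n k ≤ weight n (k + 1) := by
  unfold weight
  exact_mod_cast Nat.choose_le_choose _ (by omega)

lemma hasSum_weight (n : ℕ+) {x : ℂ} (hx : ‖x‖ < 1) :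
    HasSum (fun k => (weight n k : ℂ) * x ^ k) (((1 - x) ^ (n : ℕ))⁻¹) := by
  have h := hasSum_choose_mul_geometric_of_norm_lt_one ((n : ℕ) - 1) hx
  have hn : (n : ℕ) - 1 + 1 = n := Nat.sub_add_cancel n.pos
  rw [hn, one_div] at h
  simpa [weight] using h

variable (E) in
/-- The space `𝓜ₙ,ᴱ`: the Hilbert space of `E`-valued holomorphic functions
`f(z) = ∑ₖ √(weight n k) zᵏ aₖ` on the disc with `∑ₖ ‖aₖ‖² < ∞`, stored through the sequence `(aₖ)`
of its coordinates with respect to the normalised monomials. The `RKHS` instance below turns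
elements into functions on the disc, and `ModelSpace.kernel_eq` shows that its
reproducing kernel is `(1 - z * conj w) ^ (-n)`. -/
def ModelSpace (_n : ℕ+) : Type _ := lp (fun _ : ℕ => E) 2

namespace ModelSpace

variable {n : ℕ+}

instance : NormedAddCommGroup (ModelSpace E n) :=
  inferInstanceAs (NormedAddCommGroup (lp (fun _ : ℕ => E) 2))

instance : InnerProductSpace ℂ (ModelSpace E n) :=
  inferInstanceAs (InnerProductSpace ℂ (lp (fun _ : ℕ => E) 2))

instance [CompleteSpace E] : CompleteSpace (ModelSpace E n) :=
  inferInstanceAs (CompleteSpace (lp (fun _ : ℕ => E) 2))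

/-- The underlying square-summable sequence. -/
def toLp (f : ModelSpace E n) : lp (fun _ : ℕ => E) 2 := f

/-- The `k`-th coordinate with respect to the normalised monomials. -/
def coord (f : ModelSpace E n) (k : ℕ) : E := toLp f k

/-- The element with given square-summable coordinates. -/
def ofCoord (a : ℕ → E) (ha : Summable fun k => ‖a k‖ ^ 2) : ModelSpace E n :=
  (⟨a, memℓp_gen (by simpa using ha)⟩ : lp (fun _ : ℕ => E) 2)

@[simp] lemma coord_ofCoord (a : ℕ → E) (ha) (k : ℕ) :
    coord (ofCoord a ha : ModelSpace E n) k = a k := rfl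

@[ext] lemma ext_coord {f g : ModelSpace E n} (h : ∀ k, coord f k = coord g k) : f = g :=
  lp.ext (funext h)

@[simp] lemma coord_add (f g : ModelSpace E n) (k : ℕ) :
    coord (f + g) k = coord f k + coord g k := rfl

@[simp] lemma coord_zero (k : ℕ) : coord (0 : ModelSpace E n) k = 0 := rfl

@[simp] lemma coord_smul (c : ℂ) (f : ModelSpace E n) (k : ℕ) :
    coord (c • f) k = c • coord f k := rfl

lemma hasSum_norm_sq (f : ModelSpace E n) : HasSum (fun k => ‖coord f k‖ ^ 2) (‖f‖ ^ 2) := by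
  have h : HasSum (fun k => ‖coord f k‖ ^ (2 : ENNReal).toReal) (‖f‖ ^ (2 : ENNReal).toReal) :=
    lp.hasSum_norm (p := 2) (by simp) (toLp f)
  simpa using h

lemma inner_eq (f g : ModelSpace E n) : ⟪f, g⟫_ℂ = ∑' k, ⟪coord f k, coord g k⟫_ℂ := rfl

/-- `‖√(weight n k) zᵏ‖²` is summable for `z` in the disc. -/
lemma summable_weight_norm (n : ℕ+) (z : disc) :
    Summable fun k => weight n k * (‖(z : ℂ)‖ ^ k) ^ 2 := by
  have hz : ‖(z : ℂ)‖ < 1 := mem_ball_zero_iff.1 z.2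
  have h1 : ‖(((‖(z : ℂ)‖ ^ 2 : ℝ)) : ℂ)‖ < 1 := by
    rw [Complex.norm_real, Real.norm_of_nonneg (by positivity)]
    exact pow_lt_one₀ (norm_nonneg _) hz two_ne_zero
  have h := (hasSum_weight n h1).summable.norm
  refine h.congr fun k => ?_
  rw [norm_mul, norm_pow, Complex.norm_real, Complex.norm_real,
    Real.norm_of_nonneg (weight_pos n k).le, Real.norm_of_nonneg (by positivity), pow_right_comm]

lemma summable_eval_norm (f : ModelSpace E n) (z : disc) :
    Summable fun k => (√(weight n k) * ‖(z : ℂ)‖ ^ k) * ‖coord f k‖ := by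
  have h1 : Summable fun k => (√(weight n k) * ‖(z : ℂ)‖ ^ k) ^ 2 := by
    refine (summable_weight_norm n z).congr fun k => ?_
    rw [mul_pow, Real.sq_sqrt (weight_pos n k).le]
  refine Summable.of_nonneg_of_le (fun k => by positivity) (fun k => ?_)
    (h1.add (hasSum_norm_sq f).summable)
  nlinarith [sq_nonneg (√(weight n k) * ‖(z : ℂ)‖ ^ k - ‖coord f k‖),
    sq_nonneg (√(weight n k) * ‖(z : ℂ)‖ ^ k), sq_nonneg ‖coord f k‖]

lemma norm_eval_term (f : ModelSpace E n) (z : disc) (k : ℕ) :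
    ‖((√(weight n k) : ℂ) * (z : ℂ) ^ k) • coord f k‖
      = (√(weight n k) * ‖(z : ℂ)‖ ^ k) * ‖coord f k‖ := by
  rw [norm_smul, norm_mul, norm_pow, Complex.norm_real, Real.norm_of_nonneg (Real.sqrt_nonneg _)]

lemma summable_eval [CompleteSpace E] (f : ModelSpace E n) (z : disc) :
    Summable fun k => ((√(weight n k) : ℂ) * (z : ℂ) ^ k) • coord f k :=
  .of_norm (by simpa only [norm_eval_term] using summable_eval_norm f z)

/-- Point evaluation `f ↦ f(z)`. -/
def evalCLM [CompleteSpace E] (z : disc) : ModelSpace E n →L[ℂ] E :=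
  LinearMap.mkContinuous
    { toFun := fun f => ∑' k, ((√(weight n k) : ℂ) * (z : ℂ) ^ k) • coord f k
      map_add' := fun f g => by
        simp only [coord_add, smul_add]
        exact (summable_eval f z).tsum_add (summable_eval g z)
      map_smul' := fun c f => by
        simp only [coord_smul, RingHom.id_apply]
        rw [← (summable_eval f z).tsum_const_smul]
        exact tsum_congr fun k => smul_comm _ _ _ }
    (√(∑' k, weight n k * (‖(z : ℂ)‖ ^ k) ^ 2))
    (fun f => by
      have hs := summable_weight_norm n z
      have key := Real.inner_le_Lp_mul_Lq_tsum_of_nonneg (p := 2) (q := 2)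
        (f := fun k => √(weight n k) * ‖(z : ℂ)‖ ^ k) (g := fun k => ‖coord f k‖)
        Real.HolderConjugate.two_two (fun k => by positivity) (fun k => by positivity)
        (by
          refine hs.congr fun k => ?_
          rw [Real.rpow_two, mul_pow, Real.sq_sqrt (weight_pos n k).le])
        (by simpa using (hasSum_norm_sq f).summable)
      have h2 := key
      simp only [Real.rpow_two, (hasSum_norm_sq f).tsum_eq, mul_pow,
        Real.sq_sqrt (weight_pos n _).le, ← Real.sqrt_eq_rpow, Real.sqrt_sq (norm_nonneg f)] at h2
      refine le_trans ?_ h2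
      refine (norm_tsum_le_tsum_norm ?_).trans_eq (tsum_congr fun k => norm_eval_term f z k)
      simpa only [norm_eval_term] using summable_eval_norm f z)

lemma hasSum_evalCLM [CompleteSpace E] (f : ModelSpace E n) (z : disc) :
    HasSum (fun k => ((√(weight n k) : ℂ) * (z : ℂ) ^ k) • coord f k) (evalCLM z f) :=
  (summable_eval f z).hasSum

/-- `𝓜ₙ,ᴱ` as a reproducing kernel Hilbert space of functions on the disc:
`f(z) = ∑ₖ √(weight n k) zᵏ aₖ`. -/
instance [CompleteSpace E] : RKHS ℂ (ModelSpace E n) disc E where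
  coeCLM := ContinuousLinearMap.pi evalCLM
  coeCLM_injective := by
    rw [← ContinuousLinearMap.coe_coe, ← LinearMap.ker_eq_bot, LinearMap.ker_eq_bot']
    intro f hf
    have hf' : ∀ z, evalCLM z f = 0 := fun z => congrFun hf z
    let p : FormalMultilinearSeries ℂ ℂ E := fun k =>
      ContinuousMultilinearMap.mkPiRing ℂ (Fin k) ((√(weight n k) : ℂ) • coord f k)
    have hpc : ∀ k, p.coeff k = (√(weight n k) : ℂ) • coord f k := fun k => by
      simp [p, FormalMultilinearSeries.coeff]
    have hp : HasFPowerSeriesAt (0 : ℂ → E) p 0 := by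
      rw [hasFPowerSeriesAt_iff]
      filter_upwards [Metric.ball_mem_nhds (0 : ℂ) one_pos] with z hz
      have h := hasSum_evalCLM f ⟨z, hz⟩
      rw [hf'] at h
      simp only [Pi.zero_apply]
      convert h using 2 with k
      rw [hpc, smul_smul, mul_comm]
    have h0 := hp.eq_zero
    ext k
    have hw : (√(weight n k) : ℂ) ≠ 0 := by
      exact_mod_cast (Real.sqrt_pos.2 (weight_pos n k)).ne'
    have h2 : (√(weight n k) : ℂ) • coord f k = 0 := by
      rw [← hpc, h0]
      rfl
    exact (smul_eq_zero.1 h2).resolve_left hw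

lemma hasSum_apply [CompleteSpace E] (f : ModelSpace E n) (z : disc) :
    HasSum (fun k => ((√(weight n k) : ℂ) * (z : ℂ) ^ k) • coord f k) (f z) :=
  hasSum_evalCLM f z

/-- The reproducing kernel of `𝓜ₙ,ᴱ` is `(1 - z * conj w) ^ (-n)` times the identity of `E`. -/
theorem kernel_eq [CompleteSpace E] (z w : disc) (v : E) :
    RKHS.kernel (ModelSpace E n) z w v = ((1 - conj (w : ℂ) * (z : ℂ)) ^ (n : ℕ))⁻¹ • v := by
  have hsum : Summable fun k => ‖((√(weight n k) : ℂ) * (conj (w : ℂ)) ^ k) • v‖ ^ 2 := by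
    refine ((summable_weight_norm n w).mul_right (‖v‖ ^ 2)).congr fun k => ?_
    rw [norm_smul, norm_mul, norm_pow, Complex.norm_real,
      Real.norm_of_nonneg (Real.sqrt_nonneg _), RCLike.norm_conj, mul_pow, mul_pow,
      Real.sq_sqrt (weight_pos n k).le]
  have hk : RKHS.kerFun (ModelSpace E n) w v = ofCoord _ hsum := by
    refine ext_inner_right ℂ fun f => ?_
    rw [RKHS.kerFun_inner, inner_eq]
    have h := (hasSum_apply f w).mapL (innerSL ℂ v)
    simp only [innerSL_apply_apply] at h
    rw [← h.tsum_eq]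
    refine tsum_congr fun k => ?_
    simp [inner_smul_right, mul_comm]
  rw [← RKHS.kerFun_apply, hk]
  have h1 := hasSum_apply (ofCoord _ hsum : ModelSpace E n) z
  have hx : ‖conj (w : ℂ) * (z : ℂ)‖ < 1 := by
    have hz : ‖(z : ℂ)‖ < 1 := mem_ball_zero_iff.1 z.2
    have hw : ‖(w : ℂ)‖ < 1 := mem_ball_zero_iff.1 w.2
    rw [norm_mul, RCLike.norm_conj]
    exact mul_lt_one_of_nonneg_of_lt_one_left (norm_nonneg _) hw hz.le
  have h2 := (hasSum_weight n hx).smul_const v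
  refine h1.unique ?_
  convert h2 using 2 with k
  have hs : (√(weight n k) : ℂ) * (√(weight n k) : ℂ) = (weight n k : ℂ) := by
    exact_mod_cast Real.mul_self_sqrt (weight_pos n k).le
  rw [coord_ofCoord, smul_smul, ← hs, mul_pow]
  congr 1
  ring

/-- Coordinates of `z ↦ z f(z)`. -/
def shiftCoord (n : ℕ+) (a : ℕ → E) : ℕ → E
  | 0 => 0
  | k + 1 => ((√(weight n k) / √(weight n (k + 1)) : ℝ) : ℂ) • a k

lemma norm_shiftCoord_le (a : ℕ → E) (k : ℕ) : ‖shiftCoord n a (k + 1)‖ ^ 2 ≤ ‖a k‖ ^ 2 := by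
  have h : √(weight n k) / √(weight n (k + 1)) ≤ 1 :=
    div_le_one_of_le₀ (Real.sqrt_le_sqrt (weight_mono n k)) (Real.sqrt_nonneg _)
  rw [shiftCoord, norm_smul, Complex.norm_real, Real.norm_of_nonneg (by positivity)]
  gcongr
  exact mul_le_of_le_one_left (norm_nonneg _) h

lemma summable_shiftCoord (f : ModelSpace E n) :
    Summable fun k => ‖shiftCoord n (coord f) k‖ ^ 2 := by
  rw [← summable_nat_add_iff 1]
  exact .of_nonneg_of_le (fun k => by positivity) (fun k => norm_shiftCoord_le _ k)
    (hasSum_norm_sq f).summable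

variable (E n) in
/-- The forward shift `(S f)(z) = z f(z)` on `𝓜ₙ,ᴱ`; see `shift_apply`. -/
def shift : ModelSpace E n →L[ℂ] ModelSpace E n :=
  LinearMap.mkContinuous
    { toFun := fun f => ofCoord (shiftCoord n (coord f)) (summable_shiftCoord f)
      map_add' := fun f g => by
        ext k
        cases k <;> simp [shiftCoord]
      map_smul' := fun c f => by
        ext k
        cases k with
        | zero => simp [shiftCoord]
        | succ k => simp [shiftCoord, smul_comm c] }
    1
    (fun f => by
      rw [one_mul]
      refine le_of_sq_le_sq ?_ (norm_nonneg _)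
      rw [← (hasSum_norm_sq f).tsum_eq, ← (hasSum_norm_sq _).tsum_eq]
      have hs := summable_shiftCoord f
      rw [LinearMap.coe_mk, AddHom.coe_mk]
      simp only [coord_ofCoord]
      rw [hs.tsum_eq_zero_add]
      simp only [shiftCoord, norm_zero, ne_eq, OfNat.ofNat_ne_zero, not_false_eq_true, zero_pow,
        zero_add]
      exact ((summable_nat_add_iff 1).2 hs).tsum_le_tsum
        (fun k => norm_shiftCoord_le _ k) (hasSum_norm_sq f).summable)

theorem shift_apply [CompleteSpace E] (f : ModelSpace E n) (z : disc) :
    shift E n f z = (z : ℂ) • f z := by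
  have h1 := hasSum_apply (shift E n f) z
  have h2 := (hasSum_apply f z).const_smul (z : ℂ)
  refine h1.unique ?_
  rw [← hasSum_nat_add_iff' 1] 
  have h0 : coord (shift E n f) 0 = 0 := rfl
  simp only [Finset.range_one, Finset.sum_singleton, h0, smul_zero, sub_zero]
  convert h2 using 2 with k
  have hc : coord (shift E n f) (k + 1)
      = ((√(weight n k) / √(weight n (k + 1)) : ℝ) : ℂ) • coord f k := rfl
  have hw : (√(weight n (k + 1)) : ℂ) ≠ 0 := by
    exact_mod_cast (Real.sqrt_pos.2 (weight_pos n (k + 1))).ne'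
  rw [hc, smul_smul, smul_smul]
  congr 1
  push_cast
  field_simp
  ring

variable (E n) in
/-- The backward shift `S*` on `𝓜ₙ,ᴱ`, the adjoint of the forward shift. -/
def backwardShift [CompleteSpace E] : ModelSpace E n →L[ℂ] ModelSpace E n :=
  ContinuousLinearMap.adjoint (shift E n)

variable (n) in
/-- The monomial `zᵏ` as an element of the scalar space `𝓜ₙ`. -/
def monomial (k : ℕ) : ModelSpace ℂ n :=
  ofCoord (Pi.single k ((√(weight n k) : ℂ)⁻¹))
    (summable_of_ne_finset_zero (s := {k}) fun j hj => by
      simp [Pi.single_eq_of_ne (by simpa using hj)])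

theorem monomial_apply (k : ℕ) (z : disc) : monomial n k z = (z : ℂ) ^ k := by
  refine (hasSum_apply (monomial n k) z).unique ?_
  have hw : (√(weight n k) : ℂ) ≠ 0 := by
    exact_mod_cast (Real.sqrt_pos.2 (weight_pos n k)).ne'
  have h := hasSum_single (f := fun j => ((√(weight n j) : ℂ) * (z : ℂ) ^ j) • coord (monomial n k) j)
    k (fun j hj => by simp [monomial, Pi.single_eq_of_ne hj])
  have e : ((√(weight n k) : ℂ) * (z : ℂ) ^ k) • coord (monomial n k) k = (z : ℂ) ^ k := by
    simp only [monomial, coord_ofCoord, Pi.single_eq_same, smul_eq_mul]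
    field_simp
  rwa [e] at h

/-- The vector-valued function `z ↦ f(z) x`, for `f` in the scalar space `𝓜ₙ` and `x` in `E`. -/
def tmul (f : ModelSpace ℂ n) (x : E) : ModelSpace E n :=
  ofCoord (fun k => coord f k • x) (by
    refine ((hasSum_norm_sq f).summable.mul_right (‖x‖ ^ 2)).congr fun k => ?_
    rw [norm_smul, mul_pow])

theorem tmul_apply [CompleteSpace E] (f : ModelSpace ℂ n) (x : E) (z : disc) :
    tmul f x z = f z • x := by
  refine (hasSum_apply (tmul f x) z).unique ?_
  convert (hasSum_apply f z).smul_const x using 2 with k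
  rw [tmul, coord_ofCoord, smul_assoc]

variable (E n) in
/-- The canonical map `𝓜ₙ ⊗ E → 𝓜ₙ,ᴱ`, `f ⊗ x ↦ (z ↦ f(z) x)`. -/
def ofTensor : ModelSpace ℂ n ⊗[ℂ] E →ₗ[ℂ] ModelSpace E n :=
  TensorProduct.lift (LinearMap.mk₂ ℂ tmul
    (fun f g x => by ext k; simp [tmul, add_smul])
    (fun c f x => by ext k; simp [tmul, smul_smul])
    (fun f x y => by ext k; simp [tmul])
    (fun c f x => by ext k; simp [tmul, smul_comm c]))

variable (n) in
/-- The kernel function `K_n(·, u)` of the scalar space `𝓜ₙ`, `K_n(z, u) = (1 - z * conj u) ^ (-n)`. -/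
def kernelFun (u : disc) : ModelSpace ℂ n := RKHS.kerFun (ModelSpace ℂ n) u 1

end ModelSpace

end ModelSpace

/-! ### Hermitian holomorphic vector bundles

The bundles are families `w ↦ F w` of subspaces of a fixed inner product space, with the metric
inherited from that space, that admit holomorphic frames locally. -/

section Bundles

variable {H K : Type*} [NormedAddCommGroup H] [InnerProductSpace ℂ H]
  [NormedAddCommGroup K] [InnerProductSpace ℂ K]

/-- `γ₁, …, γₘ` is a holomorphic frame over `U` of the family of subspaces `F`. -/
def IsHolFrame {m : ℕ} (F : ℂ → Submodule ℂ H) (U : Set ℂ) (γ : Fin m → ℂ → H) : Prop :=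
  (∀ i, DifferentiableOn ℂ (γ i) U) ∧
    ∀ w ∈ U, LinearIndependent ℂ (fun i => γ i w) ∧
      Submodule.span ℂ (Set.range fun i => γ i w) = F w

/-- `{(w, x) : w ∈ Ω, x ∈ F w}` is a Hermitian holomorphic vector bundle over `Ω` of rank `m`:
near every point of `Ω` there is a holomorphic frame. -/
def IsHermHolBundle (Ω : Set ℂ) (m : ℕ) (F : ℂ → Submodule ℂ H) : Prop :=
  ∀ w ∈ Ω, ∃ U : Set ℂ, IsOpen U ∧ w ∈ U ∧ U ⊆ Ω ∧ ∃ γ : Fin m → ℂ → H, IsHolFrame F U γ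

/-- `Φ` is an equivalence over `Ω` of the Hermitian holomorphic vector bundles `F` and `G`: on the
fibres over `Ω` it is bijective, linear and isometric, and a section `s` of `F` over an open subset
of `Ω` is holomorphic exactly when the section `Φ s` of `G` is. -/
def IsHermHolEquiv (Ω : Set ℂ) (F : ℂ → Submodule ℂ H) (G : ℂ → Submodule ℂ K)
    (Φ : ∀ w, F w →ₗ[ℂ] G w) : Prop :=
  (∀ w ∈ Ω, Function.Bijective (Φ w) ∧ ∀ x y, ⟪Φ w x, Φ w y⟫_ℂ = ⟪x, y⟫_ℂ) ∧
    ∀ U ⊆ Ω, IsOpen U → ∀ s : ∀ w, F w,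
      DifferentiableOn ℂ (fun w => (s w : H)) U ↔
        DifferentiableOn ℂ (fun w => (Φ w (s w) : K)) U

/-- The tensor product of two bundles, with fibres `F w ⊗ G w` inside `H ⊗ K`. -/
def tensorBundle (F : ℂ → Submodule ℂ H) (G : ℂ → Submodule ℂ K) (w : ℂ) :
    Submodule ℂ (H ⊗[ℂ] K) :=
  LinearMap.range (TensorProduct.mapIncl (F w) (G w))

end Bundles

/-! ### Operators -/

section Operators

variable {H : Type*} [NormedAddCommGroup H] [InnerProductSpace ℂ H]

/-- The eigenvector bundle `𝓔_T` of `T`, with fibres `ker (T - w)`. -/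
def eigenBundle (T : H →L[ℂ] H) (w : ℂ) : Submodule ℂ H :=
  LinearMap.ker (T - w • ContinuousLinearMap.id ℂ H : H →L[ℂ] H).toLinearMap

/-- `T` belongs to the Cowen-Douglas class `𝓑ₘ(Ω)`. -/
structure IsCowenDouglas (Ω : Set ℂ) (m : ℕ) (T : H →L[ℂ] H) : Prop where
  subset_spectrum : Ω ⊆ spectrum ℂ T
  rank_ker : ∀ w ∈ Ω, Module.rank ℂ (eigenBundle T w) = m
  dense_span : (⨆ w ∈ Ω, eigenBundle T w).topologicalClosure = ⊤
  surjective : ∀ w ∈ Ω, Function.Surjective (T - w • ContinuousLinearMap.id ℂ H)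

variable [CompleteSpace H]

/-- `∑ⱼ (-1)ʲ (k choose j) (T*)ʲ Tʲ`, the sum being over `0 ≤ j ≤ k`. -/
def hyperSum (k : ℕ) (T : H →L[ℂ] H) : H →L[ℂ] H :=
  ∑ j ∈ Finset.range (k + 1),
    ((-1 : ℂ) ^ j * (k.choose j : ℂ)) • ((ContinuousLinearMap.adjoint T) ^ j * T ^ j)

/-- `T` is an `n`-hypercontraction. -/
def IsHypercontraction (n : ℕ+) (T : H →L[ℂ] H) : Prop :=
  ∀ k : ℕ, 1 ≤ k → k ≤ n → (hyperSum k T).IsPositive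

/-- The defect operator `D_T`, the positive square root of `hyperSum n T`. -/
def defectOp (n : ℕ+) (T : H →L[ℂ] H) : H →L[ℂ] H := CFC.sqrt (hyperSum n T)

/-- The closure of the range of the defect operator. -/
abbrev defectSpace (n : ℕ+) (T : H →L[ℂ] H) : Submodule ℂ H :=
  (LinearMap.range (defectOp n T).toLinearMap).topologicalClosure

/-- The defect operator as a map into the closure of its range. -/
def defectMap (n : ℕ+) (T : H →L[ℂ] H) : H →L[ℂ] defectSpace n T :=
  (defectOp n T).codRestrict (defectSpace n T)
    fun x => Submodule.le_topologicalClosure _ ⟨x, rfl⟩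

/-- The bundle `𝓔_{D_T}` induced by the defect operator, with fibres `D_T (ker (T - w))`; this is
the span of `D_T γ₁(w), …, D_T γₘ(w)` for any frame `γ` of `𝓔_T`. -/
def defectBundle (n : ℕ+) (T : H →L[ℂ] H) (w : ℂ) : Submodule ℂ (defectSpace n T) :=
  (eigenBundle T w).map (defectMap n T).toLinearMap

end Operators

end CowenDouglas

end

open CowenDouglas

/-!
Eigenvectors carry the whole proof. If `T x = u x` and `T y = w y`, then `(T*)ʲ Tʲ` contributes
`(conj u * w) ^ j` to the inner product, so the binomial theorem gives
`⟪D_T x, D_T y⟫ = (1 - conj u * w) ^ n * ⟪x, y⟫` (`inner_defectMap_of_mem_eigenBundle`). The factor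
is the reciprocal of the inner product of the eigenvectors `K_n(·, conj u)` and `K_n(·, conj w)` of
the scalar backward shift, so `x ↦ K_n(·, conj w) ⊗ D_T x` is isometric on fibres, and `D_T` is
injective on every `ker (T - w)`.

Expanding the kernel in a power series turns the same identity into
`∑ₖ weight n k * ⟪D_T Tᵏ x, D_T Tᵏ y⟫ = ⟪x, y⟫` for `x`, `y` in the span of the eigenvectors
(`hasSum_weight_mul_inner_defectMap`). This span is dense. Finite partial sums of
`∑ₖ weight n k * ‖D_T Tᵏ x‖ ^ 2` are therefore at most `‖x‖ ^ 2` for every `x`, which makes `V` a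
well-defined contraction, and `V` is isometric by continuity (`exists_modelMap`). The coordinates of
`V x` give `V T = S* V`, and the descriptions of the fibres inside `𝓜ₙ,ᴱ` and of `ran V` follow.

A holomorphic frame of `𝓔_T` near `w₀` comes from a bounded right inverse of `T - w₀`
(`isHermHolBundle_eigenBundle`). It is carried to the other bundles by `D_T` and by tensoring with
the line bundle `𝓔_{S*}`, which is trivialised by `w ↦ K_n(·, conj w)`. Since `𝓜ₙ ⊗ E → 𝓜ₙ,ᴱ` and
`V` are isometries, `s = V* (Φ s)` recovers a section `s` from its image, so holomorphy passes back
from `Φ s` to `s`.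
-/

noncomputable section

set_option linter.unusedSectionVars false

namespace CowenDouglas

/-! ### The backward shift and its eigenvectors -/

lemma mem_eigenBundle {H : Type*} [NormedAddCommGroup H] [InnerProductSpace ℂ H] {T : H →L[ℂ] H}
    {w : ℂ} {x : H} : x ∈ eigenBundle T w ↔ T x = w • x := by
  simp [eigenBundle, sub_eq_zero]

namespace ModelSpace

variable {E : Type*} [NormedAddCommGroup E] [InnerProductSpace ℂ E] {n : ℕ+}

lemma sqrt_weight_ne_zero (n : ℕ+) (k : ℕ) : (√(weight n k) : ℂ) ≠ 0 :=
  Complex.ofReal_ne_zero.2 (Real.sqrt_pos.2 (weight_pos n k)).ne'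

lemma sqrt_weight_mul_self (n : ℕ+) (k : ℕ) :
    (√(weight n k) : ℂ) * (√(weight n k) : ℂ) = (weight n k : ℂ) := by
  exact_mod_cast Real.mul_self_sqrt (weight_pos n k).le

@[simp] lemma weight_zero (n : ℕ+) : weight n 0 = 1 := by simp [weight]

lemma hasSum_inner (f g : ModelSpace E n) :
    HasSum (fun k => ⟪coord f k, coord g k⟫_ℂ) ⟪f, g⟫_ℂ :=
  lp.hasSum_inner (toLp f) (toLp g)

variable (n) in
/-- The element `z ↦ √(weight n k) zᵏ a`, whose only nonzero coordinate is the `k`-th one. -/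
def single (k : ℕ) (a : E) : ModelSpace E n := lp.single 2 k a

lemma coord_single (k j : ℕ) (a : E) :
    coord (single n k a) j = Pi.single (M := fun _ => E) k a j := rfl

lemma norm_single (k : ℕ) (a : E) : ‖single n k a‖ = ‖a‖ :=
  lp.norm_single (E := fun _ : ℕ => E) (p := 2) (by norm_num) k a

lemma hasSum_single_coord (f : ModelSpace E n) : HasSum (fun k => single n k (coord f k)) f :=
  lp.hasSum_single (E := fun _ : ℕ => E) (p := 2) (by norm_num) (toLp f)

lemma inner_single_left (k : ℕ) (a : E) (f : ModelSpace E n) :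
    ⟪single n k a, f⟫_ℂ = ⟪a, coord f k⟫_ℂ :=
  lp.inner_single_left (G := fun _ : ℕ => E) k a (toLp f)

lemma shift_single (k : ℕ) (a : E) :
    shift E n (single n k a)
      = single n (k + 1) (((√(weight n k) / √(weight n (k + 1)) : ℝ) : ℂ) • a) := by
  ext j
  rw [coord_single]
  change shiftCoord n _ j = _
  cases j with
  | zero => simp [shiftCoord]
  | succ j =>
    rw [shiftCoord, coord_single]
    rcases eq_or_ne j k with rfl | h
    · simp
    · simp [Pi.single_eq_of_ne h, Pi.single_eq_of_ne (show j + 1 ≠ k + 1 by omega)]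

lemma coord_backwardShift [CompleteSpace E] (f : ModelSpace E n) (k : ℕ) :
    coord (backwardShift E n f) k
      = ((√(weight n k) / √(weight n (k + 1)) : ℝ) : ℂ) • coord f (k + 1) := by
  refine ext_inner_left ℂ fun a => ?_
  rw [← inner_single_left, backwardShift, ContinuousLinearMap.adjoint_inner_right, shift_single,
    inner_single_left, inner_smul_left, inner_smul_right, Complex.conj_ofReal]

lemma coord_kernelFun (u : disc) (k : ℕ) :
    coord (kernelFun n u) k = (√(weight n k) : ℂ) * conj (u : ℂ) ^ k := by
  refine ext_inner_right ℂ fun a => ?_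
  have h1 : ⟪coord (kernelFun n u) k, a⟫_ℂ = ⟪kernelFun n u, single n k a⟫_ℂ := by
    rw [← inner_conj_symm, ← inner_single_left, inner_conj_symm]
  rw [h1, kernelFun, RKHS.kerFun_inner]
  have h2 := hasSum_apply (single n k a) u
  have h3 := hasSum_single
    (f := fun j => ((√(weight n j) : ℂ) * (u : ℂ) ^ j) • coord (single n k a) j)
    k (fun j hj => by simp [coord_single, Pi.single_eq_of_ne hj])
  rw [h2.unique h3]
  simp [coord_single, mul_comm]

lemma norm_monomial_sq (k : ℕ) : ‖monomial n k‖ ^ 2 = (weight n k)⁻¹ := by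
  have h : monomial n k = single n k ((√(weight n k) : ℂ)⁻¹) := rfl
  rw [h, norm_single, norm_inv, Complex.norm_real, Real.norm_of_nonneg (Real.sqrt_nonneg _),
    inv_pow, Real.sq_sqrt (weight_pos n k).le]

lemma smul_tmul_monomial (k : ℕ) (x : E) :
    (((‖monomial n k‖ ^ 2)⁻¹ : ℝ) : ℂ) • tmul (monomial n k) x
      = single n k ((√(weight n k) : ℂ) • x) := by
  ext j
  rw [norm_monomial_sq, inv_inv, coord_smul, tmul, coord_ofCoord, coord_single, monomial,
    coord_ofCoord]
  rcases eq_or_ne j k with rfl | h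
  · simp only [Pi.single_eq_same, smul_smul]
    rw [← sqrt_weight_mul_self, mul_assoc, mul_inv_cancel₀ (sqrt_weight_ne_zero n j), mul_one]
  · simp [Pi.single_eq_of_ne h]

/-- The kernel function `K_n(·, conj w)`, extended by zero to `w` outside the disc. It spans
`ker (S* - w)` and depends holomorphically on `w` in the disc. -/
def eigenvec (n : ℕ+) (w : ℂ) : ModelSpace ℂ n :=
  open Classical in if h : w ∈ disc then kernelFun n (conjDisc ⟨w, h⟩) else 0

lemma eigenvec_coe (w : disc) : eigenvec n w = kernelFun n (conjDisc w) := dif_pos w.2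

lemma coord_eigenvec {w : ℂ} (hw : w ∈ disc) (k : ℕ) :
    coord (eigenvec n w) k = (√(weight n k) : ℂ) * w ^ k := by
  rw [eigenvec, dif_pos hw, coord_kernelFun]
  simp [conjDisc]

lemma sqrt_weight_ratio (n : ℕ+) (k : ℕ) :
    ((√(weight n k) / √(weight n (k + 1)) : ℝ) : ℂ) * (√(weight n (k + 1)) : ℂ)
      = (√(weight n k) : ℂ) := by
  rw [Complex.ofReal_div, div_mul_cancel₀ _ (sqrt_weight_ne_zero n _)]

lemma eigenvec_mem (n : ℕ+) (w : ℂ) :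
    eigenvec n w ∈ eigenBundle (backwardShift ℂ n) w := by
  by_cases hw : w ∈ disc
  · rw [mem_eigenBundle]
    ext k
    rw [coord_backwardShift, coord_smul, coord_eigenvec hw, coord_eigenvec hw, smul_eq_mul,
      ← mul_assoc, sqrt_weight_ratio, smul_eq_mul]
    ring
  · rw [eigenvec, dif_neg hw]
    exact zero_mem _

/-- The eigenvalue equation is a two-term recursion for the coordinates, so an eigenvector is
determined by its zeroth coordinate. -/
lemma eigenBundle_backwardShift {w : ℂ} (hw : w ∈ disc) :
    eigenBundle (backwardShift ℂ n) w = Submodule.span ℂ {eigenvec n w} := by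
  refine le_antisymm (fun f hf => ?_) ?_
  · rw [mem_eigenBundle] at hf
    refine Submodule.mem_span_singleton.2 ⟨coord f 0, ?_⟩
    ext k
    rw [coord_smul, coord_eigenvec hw, smul_eq_mul]
    induction k with
    | zero => simp
    | succ k ih =>
      have h := congrArg (fun g => coord g k) hf
      simp only [coord_backwardShift, coord_smul, smul_eq_mul, ← ih] at h
      have hr : ((√(weight n k) / √(weight n (k + 1)) : ℝ) : ℂ) ≠ 0 := by
        intro h0
        have := sqrt_weight_ratio n k
        rw [h0, zero_mul] at this
        exact sqrt_weight_ne_zero n k this.symm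
      refine mul_left_cancel₀ hr ?_
      rw [h, ← sqrt_weight_ratio n k]
      ring
  · rw [Submodule.span_singleton_le_iff_mem]
    exact eigenvec_mem n w

lemma eigenvec_ne_zero {w : ℂ} (hw : w ∈ disc) : eigenvec n w ≠ 0 := by
  intro h
  have := congrArg (fun g => coord g 0) h
  simp [coord_eigenvec hw] at this

lemma norm_mul_lt_one {u w : ℂ} (hu : u ∈ disc) (hw : w ∈ disc) : ‖conj u * w‖ < 1 := by
  rw [mem_ball_zero_iff] at hu hw
  rw [norm_mul, RCLike.norm_conj]
  exact mul_lt_one_of_nonneg_of_lt_one_left (norm_nonneg _) hu hw.le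

lemma inner_eigenvec {u w : ℂ} (hu : u ∈ disc) (hw : w ∈ disc) :
    ⟪eigenvec n u, eigenvec n w⟫_ℂ = ((1 - conj u * w) ^ (n : ℕ))⁻¹ := by
  refine (hasSum_inner _ _).unique ?_
  convert hasSum_weight n (norm_mul_lt_one hu hw) using 2 with k
  rw [coord_eigenvec hu, coord_eigenvec hw, RCLike.inner_apply, ← sqrt_weight_mul_self]
  simp only [map_mul, map_pow, Complex.conj_ofReal, mul_pow]
  ring

lemma summable_sqrt_weight {r : ℝ} (h0 : 0 ≤ r) (h1 : r < 1) :
    Summable fun k => √(weight n k) * r ^ k := by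
  have h := (hasSum_weight n (x := (r : ℂ)) (by
    rwa [Complex.norm_real, Real.norm_of_nonneg h0])).summable.norm
  refine Summable.of_nonneg_of_le (fun k => by positivity) (fun k => ?_) h
  rw [norm_mul, norm_pow, Complex.norm_real, Complex.norm_real, Real.norm_of_nonneg h0,
    Real.norm_of_nonneg (weight_pos n k).le]
  -- The weights are positive integers, so `√(weight n k) ≤ weight n k`.
  have hw : 1 ≤ weight n k := by
    unfold weight
    exact_mod_cast Nat.choose_pos (Nat.le_add_left _ _)
  gcongr
  exact Real.sqrt_le_iff.2 ⟨by linarith, by nlinarith⟩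

lemma differentiableOn_eigenvec (n : ℕ+) : DifferentiableOn ℂ (eigenvec n) disc := by
  intro w hw
  -- The power series in `w` converges uniformly on every disc of radius `r < 1`.
  obtain ⟨r, hwr, hr1⟩ := exists_between (mem_ball_zero_iff.1 hw)
  have hr0 : 0 ≤ r := (norm_nonneg _).trans hwr.le
  have hsub : Metric.ball (0 : ℂ) r ⊆ disc := Metric.ball_subset_ball hr1.le
  have hd : DifferentiableOn ℂ
      (fun v : ℂ => ∑' k, v ^ k • single n k (√(weight n k) : ℂ)) (Metric.ball 0 r) := by
    refine Complex.differentiableOn_tsum_of_summable_norm (summable_sqrt_weight (n := n) hr0 hr1)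
      (fun k => ((differentiable_id.pow k).smul_const _).differentiableOn) Metric.isOpen_ball
      fun k v hv => ?_
    rw [norm_smul, norm_single, norm_pow, Complex.norm_real,
      Real.norm_of_nonneg (Real.sqrt_nonneg _), mul_comm]
    gcongr
    exact (mem_ball_zero_iff.1 hv).le
  have he : ∀ v ∈ Metric.ball (0 : ℂ) r,
      eigenvec n v = ∑' k, v ^ k • single n k (√(weight n k) : ℂ) := fun v hv => by
    rw [← (hasSum_single_coord (eigenvec n v)).tsum_eq]
    refine tsum_congr fun k => ?_
    ext j
    rw [coord_smul, coord_single, coord_single, coord_eigenvec (hsub hv)]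
    rcases eq_or_ne j k with rfl | h
    · simp [mul_comm]
    · simp [Pi.single_eq_of_ne h]
  exact ((hd.congr he).differentiableAt
    (Metric.isOpen_ball.mem_nhds (mem_ball_zero_iff.2 hwr))).differentiableWithinAt

/-! ### The tensor product inside the vector-valued space -/

lemma ofTensor_tmul (f : ModelSpace ℂ n) (x : E) : ofTensor E n (f ⊗ₜ x) = tmul f x := rfl

lemma inner_tmul_tmul (f g : ModelSpace ℂ n) (x y : E) :
    ⟪(tmul f x : ModelSpace E n), tmul g y⟫_ℂ = ⟪f, g⟫_ℂ * ⟪x, y⟫_ℂ := by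
  refine (hasSum_inner _ _).unique ?_
  have h : ∀ k, ⟪coord (tmul f x : ModelSpace E n) k, coord (tmul g y) k⟫_ℂ
      = ⟪coord f k, coord g k⟫_ℂ * ⟪x, y⟫_ℂ := fun k => by
    simp only [tmul, coord_ofCoord, inner_smul_left, inner_smul_right, RCLike.inner_apply]
    ring
  simpa only [h] using (hasSum_inner f g).mul_right ⟪x, y⟫_ℂ

lemma inner_ofTensor (s t : ModelSpace ℂ n ⊗[ℂ] E) :
    ⟪ofTensor E n s, ofTensor E n t⟫_ℂ = ⟪s, t⟫_ℂ := by
  induction s using TensorProduct.induction_on with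
  | zero => simp
  | add s₁ s₂ h₁ h₂ => rw [map_add, inner_add_left, inner_add_left, h₁, h₂]
  | tmul f x =>
    induction t using TensorProduct.induction_on with
    | zero => simp
    | add t₁ t₂ h₁ h₂ => rw [map_add, inner_add_right, inner_add_right, h₁, h₂]
    | tmul g y => rw [ofTensor_tmul, ofTensor_tmul, inner_tmul_tmul, TensorProduct.inner_tmul]

variable (E n) in
/-- The canonical map `𝓜ₙ ⊗ E → 𝓜ₙ,ᴱ` as an isometry. -/
def ofTensorIsometry : ModelSpace ℂ n ⊗[ℂ] E →ₗᵢ[ℂ] ModelSpace E n :=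
  (ofTensor E n).isometryOfInner inner_ofTensor

end ModelSpace

/-! ### Holomorphic frames of eigenvector bundles -/

section Frames

variable {H K : Type*} [NormedAddCommGroup H] [InnerProductSpace ℂ H]
  [NormedAddCommGroup K] [InnerProductSpace ℂ K]

/-- The right inverse is the inverse of the restriction of `A` to `(ker A)ᗮ`, bounded by the open
mapping theorem. -/
lemma exists_rightInverse_of_surjective [CompleteSpace H] {A : H →L[ℂ] H}
    (hA : Function.Surjective A) : ∃ R : H →L[ℂ] H, ∀ x, A (R x) = x := by
  let N : Submodule ℂ H := A.ker
  have hN : CompleteSpace N := A.isClosed_ker.completeSpace_coe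
  let B : Nᗮ →L[ℂ] H := A.comp Nᗮ.subtypeL
  have hker : B.ker = ⊥ := by
    refine LinearMap.ker_eq_bot'.2 fun x hx => ?_
    have hx' : (x : H) ∈ N := hx
    have := Submodule.inner_right_of_mem_orthogonal hx' x.2
    exact Subtype.ext (inner_self_eq_zero.1 this)
  have hran : B.range = ⊤ := by
    refine LinearMap.range_eq_top.2 fun y => ?_
    obtain ⟨x, rfl⟩ := hA y
    obtain ⟨a, ha, b, hb, rfl⟩ := N.exists_add_mem_mem_orthogonal x
    refine ⟨⟨b, hb⟩, ?_⟩
    have ha' : A a = 0 := ha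
    simp [B, ha']
  let e := ContinuousLinearEquiv.ofBijective B hker hran
  exact ⟨Nᗮ.subtypeL.comp (e.symm : H →L[ℂ] Nᗮ), fun x =>
    ContinuousLinearEquiv.ofBijective_apply_symm_apply B hker hran x⟩

/-- If `R` is a bounded right inverse of `T - w₀` and `e₁, …, eₘ` is a basis of `ker (T - w₀)`,
then `(1 - (w - w₀) R)⁻¹ eᵢ` is a holomorphic frame of `𝓔_T` near `w₀`. -/
lemma isHermHolBundle_eigenBundle [CompleteSpace H] {Ω : Set ℂ} (hΩ : IsOpen Ω) {m : ℕ}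
    {T : H →L[ℂ] H} (hT : IsCowenDouglas Ω m T) : IsHermHolBundle Ω m (eigenBundle T) := by
  intro w₀ hw₀
  obtain ⟨R, hR⟩ := exists_rightInverse_of_surjective (hT.surjective w₀ hw₀)
  let G : ℂ → H →L[ℂ] H := fun w => 1 - (w - w₀) • R
  have hG : Differentiable ℂ G := by fun_prop
  have hU : IsOpen {w | w ∈ Ω ∧ IsUnit (G w)} :=
    hΩ.inter (Units.isOpen.preimage hG.continuous)
  have hrank := hT.rank_ker w₀ hw₀
  have hfin : Module.Finite ℂ (eigenBundle T w₀) := Module.rank_lt_aleph0_iff.1 (by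
    rw [hrank]; exact Cardinal.natCast_lt_aleph0)
  let b : Module.Basis (Fin m) ℂ (eigenBundle T w₀) :=
    Module.finBasisOfFinrankEq ℂ _ (Module.finrank_eq_of_rank_eq hrank)
  refine ⟨_, hU, ⟨hw₀, by simp [G]⟩, fun w hw => hw.1,
    fun i w => Ring.inverse (G w) (b i : H), fun i w hw => ?_, fun w hw => ?_⟩
  · obtain ⟨u, hu⟩ := hw.2
    have h1 : DifferentiableAt ℂ (Ring.inverse : (H →L[ℂ] H) → _) (G w) := by
      rw [← hu]
      exact differentiableAt_inverse (𝕜 := ℂ) u.isUnit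
    exact ((h1.comp w (hG w)).clm_apply (differentiableAt_const _)).differentiableWithinAt
  · have hright : ∀ x, G w (Ring.inverse (G w) x) = x := fun x => by
      rw [← mul_apply_eq_comp, Ring.mul_inverse_cancel _ hw.2, one_apply_eq_self]
    have hmem : ∀ i, Ring.inverse (G w) (b i : H) ∈ eigenBundle T w := fun i => by
      -- `(T - w) y = (T - w₀) (G w y)`, because `(T - w₀) R = 1`.
      have h1 := hright (b i)
      set y := Ring.inverse (G w) (b i : H)
      have h2 : (T - w₀ • ContinuousLinearMap.id ℂ H) (G w y) = 0 := by
        rw [h1]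
        exact (b i).2
      have h3 := hR y
      rw [mem_eigenBundle]
      simp only [G, sub_apply, one_apply_eq_self, smul_apply, ContinuousLinearMap.id_apply, map_sub,
        map_smul] at h2 h3
      rw [h3] at h2
      rw [← sub_eq_zero, ← h2]
      module
    have hli : LinearIndependent ℂ (fun i => Ring.inverse (G w) (b i : H)) := by
      have h0 : LinearIndependent ℂ (fun i => (b i : H)) :=
        b.linearIndependent.map' (Submodule.subtype _) (Submodule.ker_subtype _)
      refine h0.map' (Ring.inverse (G w)).toLinearMap
        (LinearMap.ker_eq_bot.2 (Function.LeftInverse.injective (g := G w) hright))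
    refine ⟨hli, ?_⟩
    have hrk := hT.rank_ker w hw.1
    have hfin' : Module.Finite ℂ (eigenBundle T w) := Module.rank_lt_aleph0_iff.1 (by
      rw [hrk]; exact Cardinal.natCast_lt_aleph0)
    refine Submodule.eq_of_le_of_finrank_eq
      (Submodule.span_le.2 (Set.range_subset_iff.2 hmem)) ?_
    rw [finrank_span_eq_card hli, Fintype.card_fin, Module.finrank_eq_of_rank_eq hrk]

lemma IsHolFrame.clm_map {m : ℕ} {F : ℂ → Submodule ℂ H} {U : Set ℂ} {γ : Fin m → ℂ → H}
    (hγ : IsHolFrame F U γ) (D : H →L[ℂ] K)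
    (hD : ∀ w ∈ U, ∀ x ∈ F w, D x = 0 → x = 0) :
    IsHolFrame (fun w => (F w).map D.toLinearMap) U (fun i w => D (γ i w)) := by
  refine ⟨fun i => D.differentiable.comp_differentiableOn (hγ.1 i), fun w hw => ?_⟩
  obtain ⟨hli, hspan⟩ := hγ.2 w hw
  constructor
  · refine hli.map (f := D.toLinearMap) ?_
    rw [hspan, Submodule.disjoint_def]
    exact fun x hx h0 => hD w hw x hx h0
  · change _ = (F w).map D.toLinearMap
    rw [← hspan, Submodule.map_span, ← Set.range_comp]
    rfl

/-- The bilinear map `(x, y) ↦ x ⊗ y` is bounded for the Hilbert norm of the tensor product. -/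
lemma isBoundedBilinearMap_tmul :
    IsBoundedBilinearMap ℂ (fun p : H × K => p.1 ⊗ₜ[ℂ] p.2) where
  add_left := TensorProduct.add_tmul
  smul_left _ _ _ := TensorProduct.smul_tmul' _ _ _ |>.symm
  add_right := TensorProduct.tmul_add
  smul_right _ _ _ := TensorProduct.tmul_smul _ _ _
  bound := ⟨1, one_pos, fun x y => by simp⟩

lemma DifferentiableOn.tmul {U : Set ℂ} {f : ℂ → H} {g : ℂ → K} (hf : DifferentiableOn ℂ f U)
    (hg : DifferentiableOn ℂ g U) : DifferentiableOn ℂ (fun w => f w ⊗ₜ[ℂ] g w) U := fun w hw =>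
  (isBoundedBilinearMap_tmul.differentiableAt (f w, g w)).comp_differentiableWithinAt
    (f := fun w => (f w, g w)) w
    ((hf w hw).prodMk (hg w hw))

lemma tensorBundle_of_eq_span_singleton {F : ℂ → Submodule ℂ H} {G : ℂ → Submodule ℂ K} {w : ℂ}
    {k : H} (hk : F w = Submodule.span ℂ {k}) :
    tensorBundle F G w = (G w).map (TensorProduct.mk ℂ H K k) := by
  rw [tensorBundle, TensorProduct.range_mapIncl, hk, Submodule.map₂_span_singleton_eq_map]

lemma tmul_mem_tensorBundle {F : ℂ → Submodule ℂ H} {G : ℂ → Submodule ℂ K} {w : ℂ}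
    {x : H} {y : K} (hx : x ∈ F w) (hy : y ∈ G w) : x ⊗ₜ[ℂ] y ∈ tensorBundle F G w :=
  ⟨⟨x, hx⟩ ⊗ₜ ⟨y, hy⟩, rfl⟩

lemma tmul_eq_zero_of_left_ne {x : H} (hx : x ≠ 0) {y : K} (h : x ⊗ₜ[ℂ] y = 0) : y = 0 := by
  have h1 := congrArg norm h
  rw [TensorProduct.norm_tmul, norm_zero] at h1
  exact norm_eq_zero.1 ((mul_eq_zero.1 h1).resolve_left (norm_ne_zero_iff.2 hx))

/-- Tensoring a bundle with a line bundle that has the nowhere vanishing holomorphic section `k`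
turns frames `γᵢ` into frames `k ⊗ γᵢ`. -/
lemma IsHolFrame.tmul_line {m : ℕ} {F : ℂ → Submodule ℂ H} {G : ℂ → Submodule ℂ K} {U : Set ℂ}
    {γ : Fin m → ℂ → K} (hγ : IsHolFrame G U γ) {k : ℂ → H} (hk : DifferentiableOn ℂ k U)
    (hk0 : ∀ w ∈ U, k w ≠ 0) (hF : ∀ w ∈ U, F w = Submodule.span ℂ {k w}) :
    IsHolFrame (tensorBundle F G) U (fun i w => k w ⊗ₜ[ℂ] γ i w) := by
  refine ⟨fun i => DifferentiableOn.tmul hk (hγ.1 i), fun w hw => ?_⟩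
  obtain ⟨hli, hspan⟩ := hγ.2 w hw
  constructor
  · exact hli.map' (TensorProduct.mk ℂ H K (k w))
      (LinearMap.ker_eq_bot'.2 fun y hy => tmul_eq_zero_of_left_ne (hk0 w hw) hy)
  · rw [tensorBundle_of_eq_span_singleton (hF w hw), ← hspan, Submodule.map_span, ← Set.range_comp]
    rfl

end Frames

/-! ### The defect operator on eigenvectors -/

section Defect

variable {H : Type*} [NormedAddCommGroup H] [InnerProductSpace ℂ H] [CompleteSpace H]
  {n : ℕ+} {T : H →L[ℂ] H}

lemma pow_apply_of_mem_eigenBundle {w : ℂ} {x : H} (hx : x ∈ eigenBundle T w) (k : ℕ) :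
    (T ^ k) x = w ^ k • x := by
  rw [mem_eigenBundle] at hx
  induction k with
  | zero => simp
  | succ k ih =>
    rw [pow_succ', mul_apply_eq_comp, ih, map_smul, hx, smul_smul, pow_succ]

lemma inner_defectMap (hn : IsHypercontraction n T) (x y : H) :
    ⟪defectMap n T x, defectMap n T y⟫_ℂ = ⟪x, hyperSum n T y⟫_ℂ := by
  have hpos : 0 ≤ hyperSum n T :=
    (ContinuousLinearMap.nonneg_iff_isPositive _).2 (hn n n.pos le_rfl)
  have hsa : IsSelfAdjoint (defectOp n T) := (CFC.sqrt_nonneg (hyperSum n T)).isSelfAdjoint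
  have hsq : defectOp n T * defectOp n T = hyperSum n T := CFC.sqrt_mul_sqrt_self _ hpos
  rw [← hsq, mul_apply_eq_comp, ← ContinuousLinearMap.adjoint_inner_left (defectOp n T),
    hsa.adjoint_eq]
  rfl

/-- On eigenvectors the sum `∑ⱼ (-1)ʲ (n choose j) (T*)ʲ Tʲ` acts by the binomial expansion of
`(1 - conj u * w) ^ n`, the reciprocal of the kernel. -/
lemma inner_defectMap_of_mem_eigenBundle (hn : IsHypercontraction n T) {u w : ℂ} {x y : H}
    (hx : x ∈ eigenBundle T u) (hy : y ∈ eigenBundle T w) :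
    ⟪defectMap n T x, defectMap n T y⟫_ℂ = (1 - conj u * w) ^ (n : ℕ) * ⟪x, y⟫_ℂ := by
  rw [inner_defectMap hn, hyperSum, sum_apply, inner_sum, sub_eq_neg_add,
    add_pow, Finset.sum_mul]
  refine Finset.sum_congr rfl fun j _ => ?_
  rw [smul_apply, inner_smul_right, mul_apply_eq_comp,
    ← ContinuousLinearMap.star_eq_adjoint, ← star_pow, ContinuousLinearMap.star_eq_adjoint,
    ContinuousLinearMap.adjoint_inner_right, pow_apply_of_mem_eigenBundle hx,
    pow_apply_of_mem_eigenBundle hy, inner_smul_left, inner_smul_right,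
    neg_pow (conj u * w), mul_pow]
  simp only [map_pow, one_pow]
  ring

end Defect

/-! ### The model map -/

section Model

variable {H : Type*} [NormedAddCommGroup H] [InnerProductSpace ℂ H] [CompleteSpace H]
  {m : ℕ} {n : ℕ+} {T : H →L[ℂ] H}

open ModelSpace

lemma one_sub_conj_mul_ne_zero {u w : ℂ} (hu : u ∈ disc) (hw : w ∈ disc) : 1 - conj u * w ≠ 0 := by
  intro h
  have h1 := norm_mul_lt_one hu hw
  rw [← sub_eq_zero.1 h, norm_one] at h1
  exact lt_irrefl _ h1

lemma inner_eigenvec_mul_inner_defectMap (hn : IsHypercontraction n T) {u w : ℂ} (hu : u ∈ disc)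
    (hw : w ∈ disc) {x y : H} (hx : x ∈ eigenBundle T u) (hy : y ∈ eigenBundle T w) :
    ⟪eigenvec n u, eigenvec n w⟫_ℂ * ⟪defectMap n T x, defectMap n T y⟫_ℂ = ⟪x, y⟫_ℂ := by
  rw [inner_eigenvec hu hw, inner_defectMap_of_mem_eigenBundle hn hx hy,
    inv_mul_cancel_left₀ (pow_ne_zero _ (one_sub_conj_mul_ne_zero hu hw))]

lemma eq_zero_of_defectMap_eq_zero (hn : IsHypercontraction n T) {w : ℂ} (hw : w ∈ disc) {x : H}
    (hx : x ∈ eigenBundle T w) (h : defectMap n T x = 0) : x = 0 := by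
  rw [← inner_self_eq_zero (𝕜 := ℂ), ← inner_eigenvec_mul_inner_defectMap hn hw hw hx hx, h]
  simp

/-- Agler's identity on the span of the eigenvectors. By sesquilinearity it is enough to take `x`
and `y` to be eigenvectors, where it is the power series of the kernel. -/
lemma hasSum_weight_mul_inner_defectMap (hn : IsHypercontraction n T) {x y : H}
    (hx : x ∈ ⨆ w : disc, eigenBundle T w) (hy : y ∈ ⨆ w : disc, eigenBundle T w) :
    HasSum (fun k => (weight n k : ℂ) * ⟪defectMap n T ((T ^ k) x), defectMap n T ((T ^ k) y)⟫_ℂ)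
      ⟪x, y⟫_ℂ := by
  refine Submodule.iSup_induction (fun w : disc => eigenBundle T w) (motive := fun x => HasSum
    (fun k => (weight n k : ℂ) * ⟪defectMap n T ((T ^ k) x), defectMap n T ((T ^ k) y)⟫_ℂ)
    ⟪x, y⟫_ℂ) hx (fun u x hx => ?_) (by simp)
    fun x₁ x₂ h₁ h₂ => by simpa only [map_add, inner_add_left, mul_add] using h₁.add h₂
  refine Submodule.iSup_induction (fun w : disc => eigenBundle T w) (motive := fun y => HasSum
    (fun k => (weight n k : ℂ) * ⟪defectMap n T ((T ^ k) x), defectMap n T ((T ^ k) y)⟫_ℂ)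
    ⟪x, y⟫_ℂ) hy (fun w y hy => ?_) (by simp)
    fun y₁ y₂ h₁ h₂ => by simpa only [map_add, inner_add_right, mul_add] using h₁.add h₂
  rw [← inner_eigenvec_mul_inner_defectMap hn u.2 w.2 hx hy, inner_eigenvec u.2 w.2]
  have h : ∀ k, (weight n k : ℂ) *
      ⟪defectMap n T ((T ^ k) x), defectMap n T ((T ^ k) y)⟫_ℂ
        = (weight n k : ℂ) * (conj (u : ℂ) * w) ^ k
          * ⟪defectMap n T x, defectMap n T y⟫_ℂ := fun k => by
    rw [pow_apply_of_mem_eigenBundle hx, pow_apply_of_mem_eigenBundle hy, map_smul, map_smul,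
      inner_smul_left, inner_smul_right, map_pow, mul_pow]
    ring
  simpa only [h] using (hasSum_weight n (norm_mul_lt_one u.2 w.2)).mul_right _

lemma hasSum_weight_mul_norm_defectMap_sq (hn : IsHypercontraction n T) {x : H}
    (hx : x ∈ ⨆ w : disc, eigenBundle T w) :
    HasSum (fun k => weight n k * ‖defectMap n T ((T ^ k) x)‖ ^ 2) (‖x‖ ^ 2) := by
  have h := hasSum_weight_mul_inner_defectMap hn hx hx
  simp only [inner_self_eq_norm_sq_to_K] at h
  rw [← Complex.hasSum_ofReal]
  simp only [Complex.ofReal_mul, Complex.ofReal_pow]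
  exact h

lemma dense_iSup_eigenBundle (hT : IsCowenDouglas disc m T) :
    Dense ((⨆ w : disc, eigenBundle T w : Submodule ℂ H) : Set H) := by
  have h := hT.dense_span
  rw [iSup_subtype'] at h
  exact Submodule.dense_iff_topologicalClosure_eq_top.2 h

lemma sum_weight_mul_norm_defectMap_sq_le (hT : IsCowenDouglas disc m T)
    (hn : IsHypercontraction n T) (x : H) (s : Finset ℕ) :
    ∑ k ∈ s, weight n k * ‖defectMap n T ((T ^ k) x)‖ ^ 2 ≤ ‖x‖ ^ 2 := by
  have hc : IsClosed {x : H | ∑ k ∈ s, weight n k * ‖defectMap n T ((T ^ k) x)‖ ^ 2 ≤ ‖x‖ ^ 2} :=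
    isClosed_le (by fun_prop) (by fun_prop)
  refine hc.closure_subset_iff.2 (fun y hy => ?_) (dense_iSup_eigenBundle hT x)
  exact sum_le_hasSum s (fun k _ => mul_nonneg (weight_pos n k).le (sq_nonneg _))
    (hasSum_weight_mul_norm_defectMap_sq hn hy)

lemma norm_sqrt_weight_smul_sq {E : Type*} [NormedAddCommGroup E] [InnerProductSpace ℂ E] (k : ℕ)
    (a : E) : ‖(√(weight n k) : ℂ) • a‖ ^ 2 = weight n k * ‖a‖ ^ 2 := by
  rw [norm_smul, mul_pow, Complex.norm_real, Real.norm_of_nonneg (Real.sqrt_nonneg _),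
    Real.sq_sqrt (weight_pos n k).le]

/-- `V` is the model map `V x = ∑ₖ zᵏ / ‖zᵏ‖² ⊗ D_T Tᵏ x`, described through the coordinates of
`V x` with respect to the normalised monomials. -/
def IsModelMap (V : H →ₗᵢ[ℂ] ModelSpace (defectSpace n T) n) : Prop :=
  ∀ x k, coord (V x) k = (√(weight n k) : ℂ) • defectMap n T ((T ^ k) x)

/-- The sum of the squared norms of the coordinates is at most `‖x‖ ^ 2` for all `x` and equals it
on the dense span of the eigenvectors, hence everywhere by continuity. -/
lemma exists_modelMap (hT : IsCowenDouglas disc m T) (hn : IsHypercontraction n T) :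
    ∃ V : H →ₗᵢ[ℂ] ModelSpace (defectSpace n T) n, IsModelMap V := by
  have hs : ∀ x, Summable fun k => ‖(√(weight n k) : ℂ) • defectMap n T ((T ^ k) x)‖ ^ 2 := by
    intro x
    refine summable_of_sum_le (c := ‖x‖ ^ 2) (fun k => sq_nonneg _) fun s => ?_
    simpa only [norm_sqrt_weight_smul_sq] using sum_weight_mul_norm_defectMap_sq_le hT hn x s
  let V₀ : H →ₗ[ℂ] ModelSpace (defectSpace n T) n :=
    { toFun := fun x => ofCoord _ (hs x)
      map_add' := fun x y => by ext k : 1; simp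
      map_smul' := fun c x => by ext k : 1; simp [smul_comm c] }
  have hV₀ : ∀ x k, coord (V₀ x) k = (√(weight n k) : ℂ) • defectMap n T ((T ^ k) x) :=
    fun x k => rfl
  have hsum : ∀ x, HasSum (fun k => weight n k * ‖defectMap n T ((T ^ k) x)‖ ^ 2)
      (‖V₀ x‖ ^ 2) := fun x => by
    simpa only [hV₀, norm_sqrt_weight_smul_sq] using hasSum_norm_sq (V₀ x)
  have hle : ∀ x, ‖V₀ x‖ ≤ 1 * ‖x‖ := fun x => by
    rw [one_mul]
    refine le_of_sq_le_sq ?_ (norm_nonneg _)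
    exact hasSum_le_of_sum_le (hsum x) (sum_weight_mul_norm_defectMap_sq_le hT hn x)
  have hcont : Continuous V₀ := (V₀.mkContinuous 1 hle).continuous
  refine ⟨⟨V₀, fun x => ?_⟩, hV₀⟩
  have hc : IsClosed {x : H | ‖V₀ x‖ = ‖x‖} := isClosed_eq hcont.norm continuous_norm
  refine hc.closure_subset_iff.2 (fun y hy => ?_) (dense_iSup_eigenBundle hT x)
  exact (sq_eq_sq₀ (norm_nonneg _) (norm_nonneg _)).1
    ((hsum y).unique (hasSum_weight_mul_norm_defectMap_sq hn hy))

lemma hasSum_modelMap {V : H →ₗᵢ[ℂ] ModelSpace (defectSpace n T) n}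
    (hV : IsModelMap V) (x : H) :
    HasSum (fun k : ℕ => (((‖monomial n k‖ ^ 2)⁻¹ : ℝ) : ℂ) •
      tmul (monomial n k) (defectMap n T ((T ^ k) x))) (V x) := by
  simpa only [smul_tmul_monomial, hV _ _] using hasSum_single_coord (V x)

lemma modelMap_intertwines {V : H →ₗᵢ[ℂ] ModelSpace (defectSpace n T) n}
    (hV : IsModelMap V) (x : H) :
    V (T x) = backwardShift (defectSpace n T) n (V x) := by
  ext k : 1
  rw [coord_backwardShift, hV, hV, smul_smul, sqrt_weight_ratio, pow_succ,
    mul_apply_eq_comp]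

lemma modelMap_of_mem_eigenBundle {V : H →ₗᵢ[ℂ] ModelSpace (defectSpace n T) n}
    (hV : IsModelMap V) {w : ℂ} (hw : w ∈ disc) {x : H} (hx : x ∈ eigenBundle T w) :
    V x = tmul (eigenvec n w) (defectMap n T x) := by
  ext k : 1
  rw [hV, pow_apply_of_mem_eigenBundle hx, tmul, coord_ofCoord, coord_eigenvec hw, map_smul,
    smul_smul]

lemma tensorBundle_eq_map (T : H →L[ℂ] H) {w : ℂ} (hw : w ∈ disc) :
    tensorBundle (eigenBundle (backwardShift ℂ n)) (defectBundle n T) w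
      = (defectBundle n T w).map
          (TensorProduct.mk ℂ (ModelSpace ℂ n) (defectSpace n T) (eigenvec n w)) :=
  tensorBundle_of_eq_span_singleton (eigenBundle_backwardShift hw)

variable (n T) in
/-- The fibre maps `x ↦ K_n(·, conj w) ⊗ D_T x` of the equivalence. They vanish for `w` outside the
disc, as `eigenvec n w` does. -/
def fibreMap (w : ℂ) : eigenBundle T w →ₗ[ℂ]
    tensorBundle (eigenBundle (backwardShift ℂ n)) (defectBundle n T) w :=
  ((TensorProduct.mk ℂ (ModelSpace ℂ n) (defectSpace n T) (eigenvec n w)).comp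
    ((defectMap n T).toLinearMap.comp (eigenBundle T w).subtype)).codRestrict _ fun x =>
      tmul_mem_tensorBundle (eigenvec_mem n w) ⟨x, x.2, rfl⟩

lemma coe_fibreMap (w : ℂ) (x : eigenBundle T w) :
    (fibreMap n T w x : ModelSpace ℂ n ⊗[ℂ] defectSpace n T)
      = eigenvec n w ⊗ₜ[ℂ] defectMap n T x := rfl

lemma inner_fibreMap (hn : IsHypercontraction n T) {w : ℂ} (hw : w ∈ disc)
    (x y : eigenBundle T w) : ⟪fibreMap n T w x, fibreMap n T w y⟫_ℂ = ⟪x, y⟫_ℂ := by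
  rw [Submodule.coe_inner, coe_fibreMap, coe_fibreMap, TensorProduct.inner_tmul,
    inner_eigenvec_mul_inner_defectMap hn hw hw x.2 y.2, Submodule.coe_inner]

lemma bijective_fibreMap (hn : IsHypercontraction n T) {w : ℂ} (hw : w ∈ disc) :
    Function.Bijective (fibreMap n T w) := by
  constructor
  · refine LinearMap.ker_eq_bot.1 (LinearMap.ker_eq_bot'.2 fun x hx => ?_)
    have h := tmul_eq_zero_of_left_ne (eigenvec_ne_zero hw) (congrArg Subtype.val hx)
    exact Subtype.ext (eq_zero_of_defectMap_eq_zero hn hw x.2 h)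
  · rintro ⟨t, ht⟩
    obtain ⟨_, ⟨x, hx, rfl⟩, rfl⟩ := (tensorBundle_eq_map T hw).le ht
    exact ⟨⟨x, hx⟩, rfl⟩

lemma modelMap_eq_ofTensor_fibreMap {V : H →ₗᵢ[ℂ] ModelSpace (defectSpace n T) n}
    (hV : IsModelMap V) {w : ℂ} (hw : w ∈ disc) (x : eigenBundle T w) :
    V x = ofTensor (defectSpace n T) n (fibreMap n T w x) :=
  modelMap_of_mem_eigenBundle hV hw x.2

/-- A section `s` is recovered from its image by `s = V* (ofTensor (Φ s))`, so it is holomorphic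
when its image is. -/
lemma isHermHolEquiv_fibreMap (hn : IsHypercontraction n T)
    {V : H →ₗᵢ[ℂ] ModelSpace (defectSpace n T) n} (hV : IsModelMap V) :
    IsHermHolEquiv disc (eigenBundle T)
      (tensorBundle (eigenBundle (backwardShift ℂ n)) (defectBundle n T)) (fibreMap n T) := by
  refine ⟨fun w hw => ⟨bijective_fibreMap hn hw, inner_fibreMap hn hw⟩,
    fun U hU _ s => ⟨fun hs => ?_, fun hs => ?_⟩⟩
  · exact DifferentiableOn.tmul ((differentiableOn_eigenvec n).mono hU)
      ((defectMap n T).differentiable.comp_differentiableOn hs)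
  · let L : ModelSpace ℂ n ⊗[ℂ] defectSpace n T →L[ℂ] H :=
      (ContinuousLinearMap.adjoint V.toContinuousLinearMap).comp
        (ofTensorIsometry (defectSpace n T) n).toContinuousLinearMap
    refine (L.differentiable.comp_differentiableOn hs).congr fun w hw => ?_
    refine ext_inner_left ℂ fun y => ?_
    have h : ofTensorIsometry (defectSpace n T) n (fibreMap n T w (s w)) = V (s w) :=
      (modelMap_eq_ofTensor_fibreMap hV (hU hw) (s w)).symm
    simp only [L, Function.comp_apply, ContinuousLinearMap.comp_apply,
      LinearIsometry.coe_toContinuousLinearMap, h, ContinuousLinearMap.adjoint_inner_right,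
      LinearIsometry.inner_map_map]

lemma map_ofTensor_tensorBundle {V : H →ₗᵢ[ℂ] ModelSpace (defectSpace n T) n}
    (hV : IsModelMap V) {w : ℂ} (hw : w ∈ disc) :
    (tensorBundle (eigenBundle (backwardShift ℂ n)) (defectBundle n T) w).map
      (ofTensor (defectSpace n T) n) = (eigenBundle T w).map V.toLinearMap := by
  ext f
  rw [tensorBundle_eq_map T hw]
  constructor
  · rintro ⟨_, ⟨_, ⟨x, hx, rfl⟩, rfl⟩, rfl⟩
    exact ⟨x, hx, modelMap_of_mem_eigenBundle hV hw hx⟩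
  · rintro ⟨x, hx, rfl⟩
    exact ⟨_, ⟨_, ⟨x, hx, rfl⟩, rfl⟩, (modelMap_of_mem_eigenBundle hV hw hx).symm⟩

lemma map_modelMap_eigenBundle {V : H →ₗᵢ[ℂ] ModelSpace (defectSpace n T) n}
    (hV : ∀ x, V (T x) = backwardShift (defectSpace n T) n (V x)) (w : ℂ) :
    (eigenBundle T w).map V.toLinearMap
      = eigenBundle (backwardShift (defectSpace n T) n) w ⊓ LinearMap.range V.toLinearMap := by
  ext f
  rw [Submodule.mem_inf, mem_eigenBundle]
  constructor
  · rintro ⟨x, hx, rfl⟩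
    refine ⟨?_, x, rfl⟩
    rw [LinearIsometry.coe_toLinearMap, ← hV, mem_eigenBundle.1 hx, map_smul]
  · rintro ⟨h, x, rfl⟩
    refine ⟨x, mem_eigenBundle.2 (V.injective ?_), rfl⟩
    rw [hV, map_smul]
    exact h

lemma range_eq_topologicalClosure_iSup (hT : IsCowenDouglas disc m T) {K : Type*}
    [NormedAddCommGroup K] [InnerProductSpace ℂ K] (V : H →ₗᵢ[ℂ] K) :
    LinearMap.range V.toLinearMap
      = (⨆ w : disc, (eigenBundle T w).map V.toLinearMap).topologicalClosure := by
  rw [← Submodule.map_iSup]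
  refine SetLike.coe_injective ?_
  rw [Submodule.topologicalClosure_coe, Submodule.map_coe, LinearMap.coe_range]
  change Set.range V = closure (V '' _)
  rw [V.isometry.isClosedEmbedding.closure_image_eq, (dense_iSup_eigenBundle hT).closure_eq,
    Set.image_univ]

end Model

end CowenDouglas

end

open CowenDouglas
theorem mainTheorem9 {H : Type*} [NormedAddCommGroup H] [InnerProductSpace ℂ H] [CompleteSpace H]
    (m : ℕ) (n : ℕ+) (T : H →L[ℂ] H)
    (hT : IsCowenDouglas disc m T) (hn : IsHypercontraction n T) :
    -- the four families of subspaces are Hermitian holomorphic vector bundles over the disc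
    IsHermHolBundle disc m (eigenBundle T) ∧
    IsHermHolBundle disc 1 (eigenBundle (ModelSpace.backwardShift ℂ n)) ∧
    IsHermHolBundle disc m (defectBundle n T) ∧
    IsHermHolBundle disc m
      (tensorBundle (eigenBundle (ModelSpace.backwardShift ℂ n)) (defectBundle n T)) ∧
    -- `D_T` carries holomorphic frames of `𝓔_T` to holomorphic frames of `𝓔_{D_T}`
    (∀ U : Set ℂ, IsOpen U → U ⊆ disc → ∀ γ : Fin m → ℂ → H, IsHolFrame (eigenBundle T) U γ →
      IsHolFrame (defectBundle n T) U (fun i w => defectMap n T (γ i w))) ∧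
    -- the model map `V` and the equivalence `Φ` that it induces
    ∃ (V : H →ₗᵢ[ℂ] ModelSpace (defectSpace n T) n)
      (Φ : ∀ w, eigenBundle T w →ₗ[ℂ]
        tensorBundle (eigenBundle (ModelSpace.backwardShift ℂ n)) (defectBundle n T) w),
      (∀ x, HasSum
        (fun k : ℕ => (((‖ModelSpace.monomial n k‖ ^ 2)⁻¹ : ℝ) : ℂ) •
          ModelSpace.tmul (ModelSpace.monomial n k) (defectMap n T ((T ^ k) x))) (V x)) ∧
      (∀ x, V (T x) = ModelSpace.backwardShift (defectSpace n T) n (V x)) ∧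
      IsHermHolEquiv disc (eigenBundle T)
        (tensorBundle (eigenBundle (ModelSpace.backwardShift ℂ n)) (defectBundle n T)) Φ ∧
      (∀ (w : disc) (x : eigenBundle T w),
        (Φ w x : ModelSpace ℂ n ⊗[ℂ] defectSpace n T)
          = ModelSpace.kernelFun n (conjDisc w) ⊗ₜ[ℂ] defectMap n T x) ∧
      (∀ (w : disc) (x : eigenBundle T w),
        V x = ModelSpace.ofTensor (defectSpace n T) n (Φ w x)) ∧
      (∀ w : disc,
        (tensorBundle (eigenBundle (ModelSpace.backwardShift ℂ n)) (defectBundle n T) w).map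
            (ModelSpace.ofTensor (defectSpace n T) n)
          = eigenBundle (ModelSpace.backwardShift (defectSpace n T) n) w ⊓
              LinearMap.range V.toLinearMap) ∧
      LinearMap.range V.toLinearMap
        = (⨆ w : disc, (tensorBundle (eigenBundle (ModelSpace.backwardShift ℂ n))
            (defectBundle n T) w).map
              (ModelSpace.ofTensor (defectSpace n T) n)).topologicalClosure := by
  have h1 := isHermHolBundle_eigenBundle Metric.isOpen_ball hT
  have h2 : ∀ U : Set ℂ, U ⊆ disc → ∀ γ : Fin m → ℂ → H, IsHolFrame (eigenBundle T) U γ →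
      IsHolFrame (defectBundle n T) U (fun i w => defectMap n T (γ i w)) := fun U hU γ hγ =>
    hγ.clm_map (defectMap n T) fun w hw x hx h => eq_zero_of_defectMap_eq_zero hn (hU hw) hx h
  have hk := ModelSpace.differentiableOn_eigenvec n
  obtain ⟨V, hV⟩ := exists_modelMap hT hn
  refine ⟨h1, fun w hw => ?_, fun w hw => ?_, fun w hw => ?_, fun U _ hU => h2 U hU,
    V, fibreMap n T, hasSum_modelMap hV, modelMap_intertwines hV, isHermHolEquiv_fibreMap hn hV,
    fun w x => ?_, fun w => modelMap_eq_ofTensor_fibreMap hV w.2, fun w => ?_, ?_⟩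
  · refine ⟨disc, Metric.isOpen_ball, hw, subset_rfl, fun _ => ModelSpace.eigenvec n,
      fun _ => hk, fun v hv => ⟨?_, ?_⟩⟩
    · exact LinearIndependent.of_subsingleton 0 (ModelSpace.eigenvec_ne_zero hv)
    · rw [Set.range_const, ModelSpace.eigenBundle_backwardShift hv]
  · obtain ⟨U, hU, hwU, hUd, γ, hγ⟩ := h1 w hw
    exact ⟨U, hU, hwU, hUd, _, h2 U hUd γ hγ⟩
  · obtain ⟨U, hU, hwU, hUd, γ, hγ⟩ := h1 w hw
    exact ⟨U, hU, hwU, hUd, _, (h2 U hUd γ hγ).tmul_line (hk.mono hUd)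
      (fun v hv => ModelSpace.eigenvec_ne_zero (hUd hv))
      fun v hv => ModelSpace.eigenBundle_backwardShift (hUd hv)⟩
  · rw [coe_fibreMap, ModelSpace.eigenvec_coe]
  · rw [map_ofTensor_tensorBundle hV w.2, map_modelMap_eigenBundle (modelMap_intertwines hV)]
  · rw [range_eq_topologicalClosure_iSup hT V]
    congr 2
    funext w
    rw [map_ofTensor_tensorBundle hV w.2]
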